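/- Let $2\le N\le 2^{50}$ be an integer and let $f_1,f_2$ be integers such that $f(x)=f_1x+f_2x^2$ permutes $\mathbb Z/N\mathbb Z$; if $2\mid N$ and $4\nmid N$, assume moreover that $f_1$ is odd. Polynomials are taken with coefficients in $\mathbb Z/N\mathbb Z$ and without constant term; the degree of $g(x)=\sum_{k\ge1}g_kx^k$ is the largest $k$ with $g_k\not\equiv0\pmod N$. An inverse permutation polynomial of $f$ is such a polynomial $g$ that permutes $\mathbb Z/N\mathbb Z$ and satisfies $g(f(x))\equiv x\pmod N$ for all $x$. Write $C_k=\frac1{k+1}\binom{2k}{k}$ for the Catalan numbers. Define the following $(N-1)\times(N-1)$ matrices over $\mathbb Z/N\mathbb Z$, with indices $1\le i,j\le N-1$. The matrix $L$ is lower triangular with $l_{i,j}=\binom ij\prod_{k=i}^{i+j-1}(f_1+kf_2)$ for $i\ge j$. The matrix $D$ is diagonal with $d_{i,i}=i!$. The matrix $U$ is upper triangular with $u_{i,i}=1$ and, for $i<j$, $u_{i,j}=q^{(i,j)}V^{(i,j)}r^{(j)}$, where $q^{(i,j)}$ is the row vector with entries $(if_1+i^2f_2)^{k-1}$, $1\le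 k\le j$; $V^{(i,j)}=W^{(i-1,j)}W^{(i-2,j)}\cdots W^{(1,j)}$ (the identity if $i=1$); $W^{(k,j)}$ is the $j\times j$ matrix with entries $(kf_1+k^2f_2)^{n-m-1}$ at $(m,n)$ for $m<n$ and $0$ otherwise; and $r^{(j)}=[0,\dots,0,1]^T$ has length $j$. Then every $f_1+mf_2$ with $m\ge1$ is a unit modulo $N$ and $L$ is invertible; put $e=L^{-1}[1,2,\dots,N-1]^T$. Then $f$ has an inverse permutation polynomial, and an integer $K$ is the least degree of an inverse permutation polynomial of $f$ if and only if $K$ is the smallest integer $K\ge1$ with $$(K+1)!\,C_K\,f_2^K\equiv0\pmod N.$$ For this $K$ one has $K\le N-1$, and there are exactly $\prod_{k=1}^K\gcd(k!,N)$ inverse permutation polynomials of degree $K$. Write now $D,U,e$ for the leading $K\times K$ submatrices of $D,U$ and the leading $K\times1$ part of $e$, and identify $g=[g_1,\dots,g_K]^T$ with $\sum_{k=1}^Kg_kx^k$. (1) The inverse permutation polynomials of degree $K$ are exactly the $g$ for which there is an $h$ with $Dh\equiv e$ and $h\equiv Ug\pmod N$. (2) Let $h_k\equiv\dfrac{C_{k-1}(-f_2)^{k-1}}{\prod_{m=1}^{2k-1}(f_1+mf_2)}\pmod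 N$ for $1\le k\le K$. There is a unique $g$ with $h\equiv Ug$, and the inverse permutation polynomials of degree $K$ are exactly the sums $g+z$, where $z$ runs over the zero polynomials modulo $N$ of degree at most $K$, that is, the polynomials without constant term of degree at most $K$ (including $0$) that vanish at every residue modulo $N$. There are $\prod_{k=1}^K\gcd(k!,N)$ such $z$, and they are exactly the polynomials $$\sum_{k=1}^K\frac{N}{\gcd(k!,N)}\,\tau_k\prod_{m=0}^{k-1}(x-m),\qquad 0\le\tau_k\le\gcd(k!,N)-1.$$ -/

import Mathlib

namespace QPP

open Polynomial

/-- The quadratic polynomial `f₁ x + f₂ x²` modulo `N`. -/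
noncomputable def quad (N : ℕ) (f₁ f₂ : ℤ) : (ZMod N)[X] :=
  C (f₁ : ZMod N) * X + C (f₂ : ZMod N) * X ^ 2

/-- A permutation polynomial modulo `N`: constant-free, and permuting the residues modulo `N`.
Coefficients are taken modulo `N`, so congruent polynomials are identified (but distinct
equivalent ones are not), and `natDegree` is the largest `k` with `g_k ≢ 0 (mod N)`. -/
def IsPP {N : ℕ} (g : (ZMod N)[X]) : Prop :=
  g.coeff 0 = 0 ∧ Function.Bijective (fun x : ZMod N => g.eval x)

/-- `g` is an inverse permutation polynomial of `f`. -/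
def IsInversePP {N : ℕ} (f g : (ZMod N)[X]) : Prop :=
  IsPP g ∧ ∀ x : ZMod N, g.eval (f.eval x) = x

/-- `K` is the least degree of an inverse permutation polynomial of `f`. -/
def IsLeastInverseDegree {N : ℕ} (f : (ZMod N)[X]) (K : ℕ) : Prop :=
  IsLeast {d : ℕ | ∃ g : (ZMod N)[X], IsInversePP f g ∧ g.natDegree = d} K

/-- The inverse permutation polynomials of `f` of degree `K`. -/
def inversesOfDegree {N : ℕ} (f : (ZMod N)[X]) (K : ℕ) : Set (ZMod N)[X] :=
  {g | IsInversePP f g ∧ g.natDegree = K}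

/-- The constant-free zero polynomials modulo `N` of degree at most `K`
(the trivial one included). -/
def zeroPolys (N K : ℕ) : Set (ZMod N)[X] :=
  {z | z.coeff 0 = 0 ∧ z.natDegree ≤ K ∧ ∀ x : ZMod N, z.eval x = 0}

/-- The polynomial `∑_{k=1}^K v_k x^k`; the entry `v_k` has index `k - 1` in `Fin K`. -/
noncomputable def toPoly {N K : ℕ} (v : Fin K → ZMod N) : (ZMod N)[X] :=
  ∑ i : Fin K, C (v i) * X ^ ((i : ℕ) + 1)

section Matrices

variable {R : Type*} [CommRing R] (a b : R)

/-! Rows and columns numbered from `1` on paper are numbered from `0` in `Fin n`. Here `a`, `b`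
stand for `f₁`, `f₂`; superscripts `i`, `j`, `k` remain numbered from `1`. -/

/-- `l_{i,j} = binom(i,j) ∏_{k=i}^{i+j-1} (a + k b)` for `i ≥ j`, and `0` otherwise. -/
def matL (n : ℕ) : Matrix (Fin n) (Fin n) R := fun i j =>
  if j ≤ i then
    (Nat.choose ((i : ℕ) + 1) ((j : ℕ) + 1) : R) *
      ∏ k ∈ Finset.Ico ((i : ℕ) + 1) (((i : ℕ) + 1) + ((j : ℕ) + 1)), (a + (k : R) * b)
  else 0

/-- The diagonal matrix with entries `1!, 2!, …, n!`. -/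
def matD (n : ℕ) : Matrix (Fin n) (Fin n) R :=
  Matrix.diagonal fun i => (Nat.factorial ((i : ℕ) + 1) : R)

/-- The strictly upper triangular `j × j` matrix `W^{(k,j)}`,
with entry `(k a + k² b)^(n-m-1)` at `(m, n)` for `m < n`. -/
def matW (k j : ℕ) : Matrix (Fin j) (Fin j) R := fun m n =>
  if n ≤ m then 0 else ((k : R) * a + (k : R) ^ 2 * b) ^ ((n : ℕ) - m - 1)

/-- `V^{(i,j)} = W^{(i-1,j)} W^{(i-2,j)} ⋯ W^{(1,j)}`, the identity for `i = 1`
(the value at `i = 0` is never used). -/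
def matV (j : ℕ) : ℕ → Matrix (Fin j) (Fin j) R
  | 0 => 1
  | 1 => 1
  | i + 2 => matW a b (i + 1) j * matV j (i + 1)

/-- The row vector `q^{(i,j)}` with entries `(i a + i² b)^(k-1)`, `1 ≤ k ≤ j`. -/
def vecQ (i j : ℕ) : Fin j → R := fun k =>
  ((i : R) * a + (i : R) ^ 2 * b) ^ (k : ℕ)

/-- The column vector `r^{(j)} = [0, …, 0, 1]ᵀ`. -/
def vecR (R : Type*) [CommRing R] (j : ℕ) : Fin j → R := fun k =>
  if (k : ℕ) + 1 = j then 1 else 0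

/-- The upper unitriangular matrix `U` with `u_{i,j} = q^{(i,j)} V^{(i,j)} r^{(j)}` for `i < j`. -/
def matU (n : ℕ) : Matrix (Fin n) (Fin n) R := fun i j =>
  if i = j then 1
  else if i < j then
    vecQ a b ((i : ℕ) + 1) ((j : ℕ) + 1) ⬝ᵥ
      Matrix.mulVec (matV a b ((j : ℕ) + 1) ((i : ℕ) + 1)) (vecR R ((j : ℕ) + 1))
  else 0

/-- `b = [1, 2, …, n]ᵀ`. -/
def vecB (R : Type*) [CommRing R] (n : ℕ) : Fin n → R := fun i => ((i : ℕ) + 1 : R)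

/-- `e = L⁻¹ b`. -/
noncomputable def vecE (n : ℕ) : Fin n → R := Matrix.mulVec (matL a b n)⁻¹ (vecB R n)

end Matrices

/-- The `K × K` leading submatrix. -/
def leadMat {R : Type*} {n K : ℕ} (hK : K ≤ n) (M : Matrix (Fin n) (Fin n) R) :
    Matrix (Fin K) (Fin K) R :=
  M.submatrix (Fin.castLE hK) (Fin.castLE hK)

/-- The `K × 1` leading subvector. -/
def leadVec {R : Type*} {n K : ℕ} (hK : K ≤ n) (v : Fin n → R) : Fin K → R :=
  fun i => v (Fin.castLE hK i)

/-- The vector with `k`-th entry `C_{k-1} (-f₂)^(k-1) / ∏_{m=1}^{2k-1} (f₁ + m f₂)` modulo `N`,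
for `1 ≤ k ≤ K`, where `C_{k-1}` is a Catalan number. -/
def particularH (N : ℕ) (f₁ f₂ : ℤ) (K : ℕ) : Fin K → ZMod N := fun i =>
  (catalan (i : ℕ) : ZMod N) * (-(f₂ : ZMod N)) ^ (i : ℕ) *
    (∏ m ∈ Finset.Icc 1 (2 * ((i : ℕ) + 1) - 1), ((f₁ : ZMod N) + (m : ZMod N) * (f₂ : ZMod N)))⁻¹

/-- The polynomial `∑_{k=1}^K (N / gcd(k!, N)) τ_k ∏_{m=0}^{k-1} (x - m)` modulo `N`. -/
noncomputable def explicitZero (N K : ℕ) (τ : ℕ → ℕ) : (ZMod N)[X] :=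
  ∑ k ∈ Finset.Icc 1 K,
    C ((N / Nat.gcd (Nat.factorial k) N * τ k : ℕ) : ZMod N) *
      ∏ m ∈ Finset.range k, (X - C (m : ZMod N))

end QPP

/-! Put y_i = i f₁ + i² f₂. A constant-free g inverts f exactly when g(y_i) = i for 1 ≤ i ≤ N-1.
Expand g in the Newton basis ∏_{m<k} (X - y_m): U is the change of basis from monomials
(`matU_apply`, `toPoly_eq_newtonPoly`). Since y_i - y_m = (i-m)(f₁ + (i+m) f₂), LD is the table of
values of this basis at the nodes (`matL_mulVec_matD_mulVec`). With h = Ug the conditions read LDh =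
[1,…,N-1]ᵀ, that is Dh = e, as the units f₁ + m f₂ make L invertible.

The divided differences of the inverse function have a closed Catalan form
(`inverseDifference_succ_left`). They solve the system, so e_k is a unit times k! C_{k-1} f₂^(k-1)
(`vecE_eq_zero_iff`). Degree at most K is possible iff e_k = 0 for all k > K; each of these
quantities divides the next, so the first one decides (`factorial_catalan_pow_eq_zero_of_le`).

Two inverses differ by a zero polynomial. The same triangular system with f₁ = 1, f₂ = 0 shows that
zero polynomials are those whose falling-factorial coordinates satisfy k! c_k = 0, with gcd(k!, N)
choices for each. -/

namespace QPP

open Polynomial Finset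

/-! ### Newton basis at quadratic nodes; meaning of L, D, U -/

section Newton

variable {R : Type*} [CommRing R] (a b : R)

/-- The value `i a + i² b` of the quadratic polynomial at `i`. -/
def node (i : ℕ) : R := (i : R) * a + (i : R) ^ 2 * b

@[simp] theorem node_zero : node a b 0 = 0 := by simp [node]

/-- The Newton basis polynomial `∏_{m < k} (X - y_m)` at the nodes `y_m = m a + m² b`. -/
noncomputable def newtonBasis (k : ℕ) : R[X] := ∏ m ∈ range k, (X - C (node a b m))

/-- The coordinates of `X ^ j` in the Newton basis. -/
def newtonCoeff : ℕ → ℕ → R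
  | 0, 0 => 1
  | 0, _ + 1 => 0
  | _ + 1, 0 => 0
  | i + 1, j + 1 => newtonCoeff i j + node a b (i + 1) * newtonCoeff (i + 1) j

theorem newtonCoeff_eq_zero_of_lt {i j : ℕ} (h : j < i) : newtonCoeff a b i j = 0 := by
  induction j generalizing i with
  | zero =>
    obtain ⟨i, rfl⟩ := Nat.exists_eq_succ_of_ne_zero (by omega : i ≠ 0)
    simp [newtonCoeff]
  | succ j ih =>
    obtain ⟨i, rfl⟩ := Nat.exists_eq_succ_of_ne_zero (by omega : i ≠ 0)
    simp [newtonCoeff, ih (i := i) (by omega), ih (i := i + 1) (by omega)]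

theorem newtonCoeff_self (i : ℕ) : newtonCoeff a b i i = 1 := by
  induction i with
  | zero => simp [newtonCoeff]
  | succ i ih => simp [newtonCoeff, ih, newtonCoeff_eq_zero_of_lt a b (Nat.lt_succ_self i)]

/-- Unrolling the recursion in j gives a convolution with powers of the node, which is what `matW`
encodes. -/
theorem newtonCoeff_eq_sum (i j : ℕ) :
    newtonCoeff a b (i + 1) j =
      ∑ t ∈ range j, node a b (i + 1) ^ t * newtonCoeff a b i (j - 1 - t) := by
  induction j with
  | zero => simp [newtonCoeff]
  | succ j ih =>
    rw [newtonCoeff, ih, sum_range_succ', mul_sum, add_comm]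
    congr 1
    · refine sum_congr rfl fun t _ => ?_
      rw [pow_succ', mul_assoc]
      congr 3
      omega
    · simp

theorem newtonBasis_succ (k : ℕ) :
    newtonBasis a b (k + 1) = newtonBasis a b k * (X - C (node a b k)) := by
  rw [newtonBasis, prod_range_succ, newtonBasis]

/-- Induction on j: multiplying the i-th basis member by X gives the next member plus y_i times
itself. -/
theorem X_pow_eq_sum_newtonBasis {j n : ℕ} (h : j < n) :
    (X : R[X]) ^ j = ∑ i ∈ range n, C (newtonCoeff a b i j) * newtonBasis a b i := by
  induction j generalizing n with
  | zero =>
    rw [sum_eq_single_of_mem 0 (by simpa using h)]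
    · simp [newtonCoeff, newtonBasis]
    · intro i _ hi
      simp [newtonCoeff_eq_zero_of_lt a b (Nat.pos_of_ne_zero hi)]
  | succ j ih =>
    obtain ⟨n, rfl⟩ := Nat.exists_eq_succ_of_ne_zero (by omega : n ≠ 0)
    -- The shift costs nothing: the term at 0 vanishes since y_0 = 0, the term at n since j < n.
    have h1 : ∑ i ∈ range n, C (node a b (i + 1) * newtonCoeff a b (i + 1) j) *
          newtonBasis a b (i + 1) =
        ∑ i ∈ range n, C (node a b i * newtonCoeff a b i j) * newtonBasis a b i := by
      have e1 := sum_range_succ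
        (fun i => C (node a b i * newtonCoeff a b i j) * newtonBasis a b i) n
      rw [sum_range_succ'] at e1
      simpa [newtonCoeff_eq_zero_of_lt a b (show j < n by omega)] using e1
    rw [sum_range_succ', pow_succ, ih (show j < n by omega)]
    simp only [newtonCoeff, C_add, add_mul, sum_add_distrib, C_0, zero_mul, add_zero]
    rw [h1, ← sum_add_distrib, sum_mul]
    refine sum_congr rfl fun i _ => ?_
    rw [newtonBasis_succ, C_mul]
    ring

/-- `vecR` lists the coefficients for i = 0 in reverse order; each further factor `matW` performs
one convolution step. -/
theorem matV_mulVec_vecR (j i : ℕ) (m : Fin j) :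
    Matrix.mulVec (matV a b j (i + 1)) (vecR R j) m = newtonCoeff a b i (j - 1 - m) := by
  induction i generalizing m with
  | zero =>
    have hm := m.2
    simp only [matV, Matrix.one_mulVec, vecR]
    split_ifs with h
    · rw [show j - 1 - (m : ℕ) = 0 by omega, newtonCoeff]
    · obtain ⟨t, ht⟩ := Nat.exists_eq_succ_of_ne_zero (show j - 1 - (m : ℕ) ≠ 0 by omega)
      rw [ht, newtonCoeff]
  | succ i ih =>
    rw [matV, ← Matrix.mulVec_mulVec, newtonCoeff_eq_sum]
    simp only [Matrix.mulVec, dotProduct] at ih ⊢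
    simp only [ih, matW, Fin.le_def]
    have hm := m.2
    rw [Fin.sum_univ_eq_sum_range (fun n => (if n ≤ (m : ℕ) then (0 : R) else
      (((i + 1 : ℕ) : R) * a + ((i + 1 : ℕ) : R) ^ 2 * b) ^ (n - m - 1)) *
        newtonCoeff a b i (j - 1 - n)) j]
    rw [← sum_range_add_sum_Ico _ (show (m : ℕ) + 1 ≤ j from m.2), sum_eq_zero, zero_add,
      sum_Ico_eq_sum_range, show j - ((m : ℕ) + 1) = j - 1 - m by omega]
    · refine sum_congr rfl fun t ht => ?_
      rw [if_neg (by omega), node]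
      congr 2 <;> omega
    · intro n hn
      rw [if_pos (by simp at hn; omega), zero_mul]

theorem matU_apply (n : ℕ) (i j : Fin n) :
    matU a b n i j = newtonCoeff a b ((i : ℕ) + 1) ((j : ℕ) + 1) := by
  unfold matU
  split_ifs with h1 h2
  · rw [h1, newtonCoeff_self]
  · rw [newtonCoeff_eq_sum, dotProduct]
    simp only [matV_mulVec_vecR, vecQ]
    rw [Fin.sum_univ_eq_sum_range (fun k => ((((i : ℕ) + 1 : ℕ) : R) * a +
      (((i : ℕ) + 1 : ℕ) : R) ^ 2 * b) ^ k * newtonCoeff a b i ((j : ℕ) + 1 - 1 - k)) ((j : ℕ) + 1)]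
    rfl
  · rw [newtonCoeff_eq_zero_of_lt]
    have := lt_of_le_of_ne (not_lt.1 h2) (Ne.symm h1)
    simpa using this

theorem isUnit_matU (n : ℕ) : IsUnit (matU a b n) := by
  rw [Matrix.isUnit_iff_isUnit_det, Matrix.det_of_isUpperTriangular]
  · simp [matU]
  · intro i j hij
    rw [matU_apply, newtonCoeff_eq_zero_of_lt]
    simpa using hij

theorem isUnit_matL (h : ∀ m : ℕ, 1 ≤ m → IsUnit (a + (m : R) * b)) (n : ℕ) :
    IsUnit (matL a b n) := by
  rw [Matrix.isUnit_iff_isUnit_det, Matrix.det_of_isLowerTriangular]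
  · refine IsUnit.prod_univ_iff.2 fun i => ?_
    rw [matL, if_pos le_rfl, Nat.choose_self, Nat.cast_one, one_mul]
    refine IsUnit.prod_iff.2 fun k hk => h k ?_
    simp at hk
    omega
  · intro i j hij
    exact if_neg (not_le.2 (by simpa using hij))

/-- In y_i - y_m = (i-m)(a + (i+m)b), the factors i-m multiply to the falling factorial k!
binom(i,k), zero when i < k. -/
theorem eval_newtonBasis_node (k i : ℕ) :
    (newtonBasis a b k).eval (node a b i) =
      (k.factorial : R) * ((i.choose k : R) * ∏ t ∈ Ico i (i + k), (a + (t : R) * b)) := by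
  induction k with
  | zero => simp [newtonBasis]
  | succ k ih =>
    have hc : ((k + 1).factorial : R) * (i.choose (k + 1) : R) =
        (k.factorial : R) * ((i.choose k : R) * ((i : R) - k)) := by
      have e : (i.choose (k + 1) : R) * ((k : R) + 1) = (i.choose k : R) * ((i : R) - k) := by
        rcases le_or_gt k i with hk | hk
        · rw [← Nat.cast_sub hk]
          exact_mod_cast congrArg (Nat.cast (R := R)) (Nat.choose_succ_right_eq i k)
        · simp [Nat.choose_eq_zero_of_lt hk, Nat.choose_eq_zero_of_lt (show i < k + 1 by omega)]
      rw [Nat.factorial_succ, ← e]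
      push_cast
      ring
    rw [newtonBasis_succ, eval_mul, ih, ← add_assoc, prod_Ico_succ_top (by omega), ← mul_assoc _ _
      (_ * _), hc]
    simp only [eval_sub, eval_X, eval_C, node]
    push_cast
    ring

theorem matL_mulVec_matD_mulVec (n : ℕ) (h : Fin n → R) (i : Fin n) :
    Matrix.mulVec (matL a b n) (Matrix.mulVec (matD n) h) i =
      ∑ k : Fin n, h k * (newtonBasis a b ((k : ℕ) + 1)).eval (node a b ((i : ℕ) + 1)) := by
  rw [Matrix.mulVec, dotProduct]
  refine sum_congr rfl fun k _ => ?_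
  rw [matD, Matrix.mulVec_diagonal, eval_newtonBasis_node, matL]
  split_ifs with hk
  · ring
  · rw [Nat.choose_eq_zero_of_lt (by simpa using hk)]
    simp

end Newton

/-! ### Divided differences of the inverse, and the vector e -/

/-- Newton interpolation from a table `h` of divided differences at the nodes `y`. -/
theorem sum_dividedDifference_mul_prod {R : Type*} [CommRing R] (y : ℕ → R) (h : ℕ → ℕ → R)
    (hrec : ∀ s k, h (s + 1) k = h s k + h s (k + 1) * (y (s + k + 1) - y s)) (s n : ℕ) :
    ∑ k ∈ range (n + 1), h s k * ∏ m ∈ range k, (y (s + n) - y (s + m)) = h (s + n) 0 := by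
  induction n generalizing s with
  | zero => simp
  | succ n ih =>
    rw [show s + (n + 1) = s + 1 + n by ring, ← ih (s + 1)]
    -- The induction moves the base node from y_s to y_{s+1}; Q is the product for the new base, and
    -- the discrepancy telescopes because Q (n+1) = 0.
    set Q : ℕ → R := fun k => ∏ m ∈ range k, (y (s + 1 + n) - y (s + 1 + m)) with hQ
    have hQs : ∀ k, Q (k + 1) = Q k * (y (s + 1 + n) - y (s + 1 + k)) := fun k => by
      simp only [hQ, prod_range_succ]
    have hP : ∀ k, ∏ m ∈ range (k + 1), (y (s + 1 + n) - y (s + m)) =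
        Q k * (y (s + 1 + n) - y s) := fun k => by
      rw [prod_range_succ']
      simp only [hQ, add_zero]
      congr 1
      exact prod_congr rfl fun m _ => by rw [show s + (m + 1) = s + 1 + m by ring]
    have hQn : Q (n + 1) = 0 := by rw [hQs, sub_self, mul_zero]
    have tel := sum_range_sub (fun k => h s k * Q k) (n + 1)
    rw [hQn, mul_zero, zero_sub] at tel
    have hQ0 : Q 0 = 1 := by simp [hQ]
    rw [hQ0, mul_one] at tel
    rw [sum_range_succ', range_zero, prod_empty, mul_one, show h s 0 =
      -∑ i ∈ range (n + 1), (h s (i + 1) * Q (i + 1) - h s i * Q i) by rw [tel, neg_neg],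
      ← sum_neg_distrib, ← sum_add_distrib]
    refine sum_congr rfl fun k _ => ?_
    rw [hP, hQs, hrec, show s + k + 1 = s + 1 + k by ring]
    ring

theorem catalan_succ_mul (k : ℕ) : catalan (k + 1) * (k + 2) = 2 * (2 * k + 1) * catalan k := by
  have h1 := succ_mul_catalan_eq_centralBinom (k + 1)
  have h2 := succ_mul_catalan_eq_centralBinom k
  have h3 := Nat.succ_mul_centralBinom_succ k
  rw [← h1, ← h2] at h3
  refine Nat.eq_of_mul_eq_mul_left (Nat.succ_pos k) ?_
  rw [Nat.succ_eq_add_one]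
  linarith

theorem factorial_mul_catalan_succ (k : ℕ) :
    (k + 2).factorial * catalan (k + 1) =
      (k + 1).factorial * catalan k * (2 * (2 * k + 1)) := by
  rw [Nat.factorial_succ (k + 1), mul_right_comm, mul_comm (k + 1 + 1), catalan_succ_mul]
  ring

theorem prod_Icc_one_eq_prod_range {M : Type*} [CommMonoid M] (F : ℕ → M) (n : ℕ) :
    ∏ m ∈ Icc 1 n, F m = ∏ m ∈ range n, F (m + 1) := by
  induction n with
  | zero => simp
  | succ n ih => rw [prod_Icc_succ_top (by omega), ih, prod_range_succ]

variable {N : ℕ}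

theorem zmod_inv_eq_mul_inv {p q u : ZMod N} (h : p * q = u) (hu : IsUnit u) :
    p⁻¹ = q * u⁻¹ :=
  ZMod.inv_eq_of_mul_eq_one N _ _ (by rw [← mul_assoc, h, ZMod.mul_inv_of_unit u hu])

/-- The divided differences of the inverse of `x ↦ a x + b x²` at the nodes
`y_s, …, y_{s + k}`. -/
def inverseDifference (a b : ZMod N) : ℕ → ℕ → ZMod N
  | s, 0 => s
  | s, k + 1 => (catalan k : ZMod N) * (-b) ^ k *
      (∏ m ∈ range (2 * k + 1), (a + ((2 * s + m + 1 : ℕ) : ZMod N) * b))⁻¹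

/-- Over a common denominator, with A = a + 2sb, the order k+1 case is (A+b)(A+2b) -
(A+(2k+2)b)(A+(2k+3)b) = -2(2k+1) b (A+(k+2)b), matched by (k+2) C_{k+1} = 2(2k+1) C_k. -/
theorem inverseDifference_succ_left {a b : ZMod N}
    (hu : ∀ m : ℕ, 1 ≤ m → IsUnit (a + (m : ZMod N) * b)) (s k : ℕ) :
    inverseDifference a b (s + 1) k = inverseDifference a b s k +
      inverseDifference a b s (k + 1) * (node a b (s + k + 1) - node a b s) := by
  cases k with
  | zero =>
    have h := ZMod.inv_mul_of_unit _ (hu (2 * s + 1) (by omega))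
    have e : node a b (s + 1) - node a b s = a + ((2 * s + 1 : ℕ) : ZMod N) * b := by
      simp only [node]; push_cast; ring
    simp only [inverseDifference, add_zero, e]
    simp [-Nat.cast_add, -Nat.cast_mul, h]
    exact Nat.cast_succ s
  | succ k =>
    set F : ℕ → ZMod N := fun m => a + ((2 * s + m + 1 : ℕ) : ZMod N) * b with hF
    have hU : IsUnit (∏ m ∈ range (2 * (k + 1) + 1), F m) :=
      IsUnit.prod_iff.2 fun m _ => hu _ (by omega)
    have h1 : (∏ m ∈ range (2 * k + 1), F m)⁻¹ =
        F (2 * k + 1) * F (2 * k + 2) * (∏ m ∈ range (2 * (k + 1) + 1), F m)⁻¹ := by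
      refine zmod_inv_eq_mul_inv ?_ hU
      rw [show 2 * (k + 1) + 1 = 2 * k + 1 + 1 + 1 by ring, prod_range_succ F (2 * k + 1 + 1),
        prod_range_succ F (2 * k + 1), mul_assoc]
    have h2 : (∏ m ∈ range (2 * k + 1), (a + ((2 * (s + 1) + m + 1 : ℕ) : ZMod N) * b))⁻¹ =
        F 0 * F 1 * (∏ m ∈ range (2 * (k + 1) + 1), F m)⁻¹ := by
      refine zmod_inv_eq_mul_inv ?_ hU
      rw [show 2 * (k + 1) + 1 = 2 * k + 1 + 1 + 1 by ring, prod_range_succ' F (2 * k + 1 + 1),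
        prod_range_succ' _ (2 * k + 1), mul_comm (F 0), mul_assoc]
      congr 1
      refine prod_congr rfl fun m _ => ?_
      simp only [hF]
      congr 3
      ring
    have hc : (catalan (k + 1) : ZMod N) * ((k : ZMod N) + 2) =
        2 * (2 * (k : ZMod N) + 1) * catalan k := by
      exact_mod_cast congrArg (Nat.cast (R := ZMod N)) (catalan_succ_mul k)
    have hd : node a b (s + (k + 1) + 1) - node a b s =
        ((k : ZMod N) + 2) * (a + (2 * (s : ZMod N) + k + 2) * b) := by
      simp only [node]; push_cast; ring
    simp only [inverseDifference]
    rw [h1, h2, hd]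
    generalize (∏ m ∈ range (2 * (k + 1) + 1), F m)⁻¹ = u
    simp only [hF]
    push_cast
    linear_combination (-(-b) ^ (k + 1) * u * (a + (2 * (s : ZMod N) + k + 2) * b)) * hc

theorem particularH_apply (f₁ f₂ : ℤ) (K : ℕ) (i : Fin K) :
    particularH N f₁ f₂ K i =
      inverseDifference (f₁ : ZMod N) (f₂ : ZMod N) 0 ((i : ℕ) + 1) := by
  rw [particularH, inverseDifference, prod_Icc_one_eq_prod_range,
    show 2 * ((i : ℕ) + 1) - 1 = 2 * (i : ℕ) + 1 by omega]
  simp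

theorem matL_mulVec_matD_mulVec_particularH {f₁ f₂ : ℤ}
    (hu : ∀ m : ℕ, 1 ≤ m → IsUnit ((f₁ : ZMod N) + (m : ZMod N) * (f₂ : ZMod N))) (n : ℕ) :
    Matrix.mulVec (matL (f₁ : ZMod N) (f₂ : ZMod N) n)
      (Matrix.mulVec (matD n) (particularH N f₁ f₂ n)) = vecB (ZMod N) n := by
  ext i
  rw [matL_mulVec_matD_mulVec]
  simp only [particularH_apply, vecB]
  have h := sum_dividedDifference_mul_prod (node (f₁ : ZMod N) (f₂ : ZMod N)) _
    (inverseDifference_succ_left hu) 0 ((i : ℕ) + 1)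
  rw [sum_range_succ'] at h
  simp only [zero_add, inverseDifference, Nat.cast_zero, zero_mul, add_zero] at h
  rw [Fin.sum_univ_eq_sum_range (fun k => inverseDifference (f₁ : ZMod N) (f₂ : ZMod N) 0 (k + 1) *
    (newtonBasis (f₁ : ZMod N) (f₂ : ZMod N) (k + 1)).eval
      (node (f₁ : ZMod N) (f₂ : ZMod N) ((i : ℕ) + 1))) n]
  have hi := i.2
  -- Basis members of degree above i + 1 vanish at this node, so the full row is the truncated
  -- Newton sum.
  rw [← sum_subset (range_mono (show (i : ℕ) + 1 ≤ n from hi))]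
  · push_cast at h
    rw [← h]
    refine sum_congr rfl fun k _ => ?_
    simp [newtonBasis, eval_prod, inverseDifference]
  · intro k _ hk
    rw [eval_newtonBasis_node, Nat.choose_eq_zero_of_lt (by simp at hk; omega)]
    simp

theorem vecE_eq {f₁ f₂ : ℤ}
    (hu : ∀ m : ℕ, 1 ≤ m → IsUnit ((f₁ : ZMod N) + (m : ZMod N) * (f₂ : ZMod N))) (n : ℕ) :
    vecE (f₁ : ZMod N) (f₂ : ZMod N) n = Matrix.mulVec (matD n) (particularH N f₁ f₂ n) := by
  have hL := isUnit_matL _ _ hu n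
  rw [vecE, ← matL_mulVec_matD_mulVec_particularH hu, Matrix.mulVec_mulVec,
    Matrix.nonsing_inv_mul _ ((Matrix.isUnit_iff_isUnit_det _).1 hL), Matrix.one_mulVec]

theorem vecE_eq_zero_iff {f₁ f₂ : ℤ}
    (hu : ∀ m : ℕ, 1 ≤ m → IsUnit ((f₁ : ZMod N) + (m : ZMod N) * (f₂ : ZMod N))) (n : ℕ)
    (k : Fin n) : vecE (f₁ : ZMod N) (f₂ : ZMod N) n k = 0 ↔
      (((((k : ℕ) + 1).factorial : ℤ) * (catalan k : ℤ) * f₂ ^ (k : ℕ) : ℤ) : ZMod N) = 0 := by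
  rw [vecE_eq hu, matD, Matrix.mulVec_diagonal, particularH]
  have hU : IsUnit (∏ m ∈ Icc 1 (2 * ((k : ℕ) + 1) - 1),
      ((f₁ : ZMod N) + (m : ZMod N) * (f₂ : ZMod N))) :=
    IsUnit.prod_iff.2 fun m hm => hu _ (mem_Icc.1 hm).1
  have hU' := isUnit_iff_exists_inv.2 ⟨_, ZMod.inv_mul_of_unit _ hU⟩
  rw [← mul_assoc, hU'.mul_left_eq_zero, neg_pow, mul_left_comm, ← mul_assoc, mul_left_comm,
    ((isUnit_one.neg.pow (k : ℕ))).mul_right_eq_zero]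
  push_cast
  rw [mul_comm (catalan (k : ℕ) : ZMod N)]

/-! ### Polynomials without constant term -/

theorem coeff_toPoly_zero {K : ℕ} (v : Fin K → ZMod N) : (toPoly v).coeff 0 = 0 := by
  simp [toPoly]

theorem coeff_toPoly_succ {K : ℕ} (v : Fin K → ZMod N) (i : Fin K) :
    (toPoly v).coeff ((i : ℕ) + 1) = v i := by
  simp [toPoly, coeff_X_pow, Fin.val_inj]

theorem toPoly_injective {K : ℕ} : Function.Injective (toPoly (N := N) (K := K)) := by
  intro v w h
  ext i
  rw [← coeff_toPoly_succ v, h, coeff_toPoly_succ]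

theorem natDegree_toPoly_le {K : ℕ} (v : Fin K → ZMod N) : (toPoly v).natDegree ≤ K :=
  natDegree_sum_le_of_forall_le _ _ fun i _ => (natDegree_C_mul_X_pow_le _ _).trans i.2

theorem exists_eq_toPoly {K : ℕ} {g : (ZMod N)[X]} (h0 : g.coeff 0 = 0) (hd : g.natDegree ≤ K) :
    ∃ v : Fin K → ZMod N, g = toPoly v := by
  refine ⟨fun i => g.coeff ((i : ℕ) + 1), ?_⟩
  conv_lhs => rw [g.as_sum_range_C_mul_X_pow' (show g.natDegree < K + 1 by omega), sum_range_succ']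
  rw [h0, C_0, zero_mul, add_zero, sum_range]
  rfl

/-- The polynomial with given coordinates in the Newton basis without its constant member. -/
noncomputable def newtonPoly (a b : ZMod N) {K : ℕ} (h : Fin K → ZMod N) : (ZMod N)[X] :=
  ∑ k : Fin K, C (h k) * newtonBasis a b ((k : ℕ) + 1)

/-- The constant Newton coordinate of X^(j+1) is zero because y_0 = 0, so only `matU` remains. -/
theorem toPoly_eq_newtonPoly (a b : ZMod N) {K : ℕ} (v : Fin K → ZMod N) :
    toPoly v = newtonPoly a b (Matrix.mulVec (matU a b K) v) := by
  simp only [toPoly, newtonPoly, Matrix.mulVec, dotProduct, map_sum, sum_mul]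
  rw [sum_comm]
  refine sum_congr rfl fun j _ => ?_
  rw [X_pow_eq_sum_newtonBasis a b (show (j : ℕ) + 1 < K + 1 by simp), sum_range_succ']
  simp only [newtonCoeff, C_0, zero_mul, add_zero, mul_sum]
  rw [sum_range]
  refine sum_congr rfl fun i _ => ?_
  rw [matU_apply, newtonCoeff, C_mul]
  ring

theorem exists_matU_mulVec_eq (a b : ZMod N) {K : ℕ} (h : Fin K → ZMod N) :
    ∃ v, h = Matrix.mulVec (matU a b K) v :=
  ⟨Matrix.mulVec (matU a b K)⁻¹ h, by
    rw [Matrix.mulVec_mulVec, Matrix.mul_nonsing_inv _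
      ((Matrix.isUnit_iff_isUnit_det _).1 (isUnit_matU a b K)), Matrix.one_mulVec]⟩

theorem newtonPoly_injective (a b : ZMod N) {K : ℕ} :
    Function.Injective (newtonPoly a b (K := K)) := by
  intro h h' e
  obtain ⟨v, rfl⟩ := exists_matU_mulVec_eq a b h
  obtain ⟨w, rfl⟩ := exists_matU_mulVec_eq a b h'
  rw [← toPoly_eq_newtonPoly, ← toPoly_eq_newtonPoly] at e
  rw [toPoly_injective e]

theorem coeff_newtonPoly_zero (a b : ZMod N) {K : ℕ} (h : Fin K → ZMod N) :
    (newtonPoly a b h).coeff 0 = 0 := by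
  obtain ⟨v, rfl⟩ := exists_matU_mulVec_eq a b h
  rw [← toPoly_eq_newtonPoly, coeff_toPoly_zero]

theorem natDegree_newtonPoly_le (a b : ZMod N) {K : ℕ} (h : Fin K → ZMod N) :
    (newtonPoly a b h).natDegree ≤ K := by
  obtain ⟨v, rfl⟩ := exists_matU_mulVec_eq a b h
  rw [← toPoly_eq_newtonPoly]
  exact natDegree_toPoly_le v

theorem exists_eq_newtonPoly (a b : ZMod N) {K : ℕ} {g : (ZMod N)[X]} (h0 : g.coeff 0 = 0)
    (hd : g.natDegree ≤ K) : ∃ h : Fin K → ZMod N, g = newtonPoly a b h := by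
  obtain ⟨v, rfl⟩ := exists_eq_toPoly h0 hd
  exact ⟨_, toPoly_eq_newtonPoly a b v⟩

theorem eval_newtonPoly_node (a b : ZMod N) {K : ℕ} (h : Fin K → ZMod N) (i : Fin K) :
    (newtonPoly a b h).eval (node a b ((i : ℕ) + 1)) =
      Matrix.mulVec (matL a b K) (Matrix.mulVec (matD K) h) i := by
  rw [matL_mulVec_matD_mulVec, newtonPoly, eval_finsetSum]
  simp

/-! ### Zero polynomials -/

theorem natCast_mul_eq_zero_iff [NeZero N] (m : ℕ) (x : ZMod N) :
    (m : ZMod N) * x = 0 ↔ ∃ τ < Nat.gcd m N, x = ((N / Nat.gcd m N * τ : ℕ) : ZMod N) := by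
  have hN : 0 < N := Nat.pos_of_neZero N
  have hg : 0 < Nat.gcd m N := Nat.gcd_pos_of_pos_right m hN
  have hgN : Nat.gcd m N * (N / Nat.gcd m N) = N := Nat.mul_div_cancel' (Nat.gcd_dvd_right m N)
  have hgm : Nat.gcd m N * (m / Nat.gcd m N) = m := Nat.mul_div_cancel' (Nat.gcd_dvd_left m N)
  constructor
  · intro h
    rw [← ZMod.natCast_zmod_val x, ← Nat.cast_mul, ZMod.natCast_eq_zero_iff] at h
    have hd : N / Nat.gcd m N ∣ x.val := by
      refine (Nat.coprime_div_gcd_div_gcd hg).symm.dvd_of_dvd_mul_left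
        (Nat.dvd_of_mul_dvd_mul_left hg ?_)
      rwa [hgN, ← mul_assoc, hgm]
    obtain ⟨τ, hτ⟩ := hd
    refine ⟨τ, ?_, by rw [← hτ, ZMod.natCast_zmod_val]⟩
    have hlt := x.val_lt
    rw [hτ] at hlt
    by_contra hle
    have := Nat.mul_le_mul_left (N / Nat.gcd m N) (not_lt.1 hle)
    rw [mul_comm _ (Nat.gcd m N), hgN] at this
    omega
  · rintro ⟨τ, _, rfl⟩
    rw [← Nat.cast_mul, ZMod.natCast_eq_zero_iff]
    refine ⟨m / Nat.gcd m N * τ, ?_⟩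
    calc m * (N / Nat.gcd m N * τ)
        = Nat.gcd m N * (m / Nat.gcd m N) * (N / Nat.gcd m N * τ) := by rw [hgm]
      _ = Nat.gcd m N * (N / Nat.gcd m N) * (m / Nat.gcd m N * τ) := by ring
      _ = _ := by rw [hgN]

theorem card_filter_natCast_mul_eq_zero [NeZero N] (m : ℕ) :
    (univ.filter fun x : ZMod N => (m : ZMod N) * x = 0).card = Nat.gcd m N := by
  have hN : 0 < N := Nat.pos_of_neZero N
  have hg : 0 < Nat.gcd m N := Nat.gcd_pos_of_pos_right m hN
  have hgN : N / Nat.gcd m N * Nat.gcd m N = N := Nat.div_mul_cancel (Nat.gcd_dvd_right m N)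
  have hq : 0 < N / Nat.gcd m N := Nat.pos_of_mul_pos_right (hgN ▸ hN)
  have e : (univ.filter fun x : ZMod N => (m : ZMod N) * x = 0) =
      (range (Nat.gcd m N)).image fun τ => ((N / Nat.gcd m N * τ : ℕ) : ZMod N) := by
    ext x
    simp only [mem_filter, mem_univ, true_and, natCast_mul_eq_zero_iff, mem_image, mem_range]
    exact exists_congr fun τ => and_congr_right fun _ => eq_comm
  rw [e, card_image_of_injOn, card_range]
  intro τ hτ σ hσ h
  have hlt : ∀ ρ, ρ < Nat.gcd m N → N / Nat.gcd m N * ρ < N := fun ρ hρ =>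
    lt_of_lt_of_eq (Nat.mul_lt_mul_of_pos_left hρ hq) hgN
  simp only [coe_range, Set.mem_Iio] at hτ hσ
  have := congrArg ZMod.val h
  rw [ZMod.val_natCast_of_lt (hlt _ hτ), ZMod.val_natCast_of_lt (hlt _ hσ)] at this
  exact Nat.eq_of_mul_eq_mul_left hq this

/-- At a = 1, b = 0 the nodes are 0, 1, 2, … and L has unit diagonal. Vanishing at 1, …, K already
forces Dc = 0. -/
theorem newtonPoly_mem_zeroPolys_iff [NeZero N] {K : ℕ} (c : Fin K → ZMod N) :
    newtonPoly 1 0 c ∈ zeroPolys N K ↔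
      ∀ k : Fin K, (((k : ℕ) + 1).factorial : ZMod N) * c k = 0 := by
  constructor
  · rintro ⟨-, -, h⟩
    have hL : Matrix.mulVec (matL (1 : ZMod N) 0 K) (Matrix.mulVec (matD K) c) = 0 := by
      ext i
      rw [← eval_newtonPoly_node, h, Pi.zero_apply]
    have hD : Matrix.mulVec (matD K) c = 0 :=
      Matrix.mulVec_injective_of_isUnit (isUnit_matL (1 : ZMod N) 0 (by simp) K)
        (hL.trans (Matrix.mulVec_zero _).symm)
    intro k
    simpa [matD, Matrix.mulVec_diagonal] using congrFun hD k
  · intro h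
    refine ⟨coeff_newtonPoly_zero _ _ _, natDegree_newtonPoly_le _ _ _, fun x => ?_⟩
    have hx : x = node (1 : ZMod N) 0 x.val := by simp [node]
    rw [hx, newtonPoly, eval_finsetSum]
    refine sum_eq_zero fun k _ => ?_
    rw [eval_mul, eval_C, eval_newtonBasis_node, ← mul_assoc, mul_comm (c k), h, zero_mul]

theorem zeroPolys_eq_image [NeZero N] (K : ℕ) :
    zeroPolys N K = newtonPoly 1 0 '' (Fintype.piFinset fun k : Fin K =>
      univ.filter fun x : ZMod N => (((k : ℕ) + 1).factorial : ZMod N) * x = 0 :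
        Set (Fin K → ZMod N)) := by
  ext z
  constructor
  · intro hz
    obtain ⟨c, rfl⟩ := exists_eq_newtonPoly 1 0 hz.1 hz.2.1
    exact ⟨c, by simpa using (newtonPoly_mem_zeroPolys_iff c).1 hz, rfl⟩
  · rintro ⟨c, hc, rfl⟩
    exact (newtonPoly_mem_zeroPolys_iff c).2 (by simpa using hc)

theorem ncard_zeroPolys [NeZero N] (K : ℕ) :
    (zeroPolys N K).ncard = ∏ k ∈ Icc 1 K, Nat.gcd (Nat.factorial k) N := by
  rw [zeroPolys_eq_image, Set.ncard_image_of_injective _ (newtonPoly_injective 1 0),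
    Set.ncard_coe_finset, Fintype.card_piFinset, prod_Icc_one_eq_prod_range, prod_range]
  simp only [card_filter_natCast_mul_eq_zero]

theorem explicitZero_eq_newtonPoly (K : ℕ) (τ : ℕ → ℕ) :
    explicitZero N K τ = newtonPoly 1 0 fun k : Fin K =>
      ((N / Nat.gcd (Nat.factorial ((k : ℕ) + 1)) N * τ ((k : ℕ) + 1) : ℕ) : ZMod N) := by
  -- `Multiplicative` turns the product reindexing into one for sums.
  have h := prod_Icc_one_eq_prod_range (M := Multiplicative (ZMod N)[X]) (fun k =>
    Multiplicative.ofAdd (C ((N / Nat.gcd (Nat.factorial k) N * τ k : ℕ) : ZMod N) *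
      ∏ m ∈ range k, (X - C (m : ZMod N)))) K
  rw [explicitZero, newtonPoly]
  refine (congrArg Multiplicative.toAdd h).trans ?_
  rw [prod_range]
  simp [newtonBasis, node]

theorem zeroPolys_eq_explicitZero [NeZero N] (K : ℕ) :
    zeroPolys N K = {z | ∃ τ : ℕ → ℕ,
      (∀ k ∈ Icc 1 K, τ k ≤ Nat.gcd (Nat.factorial k) N - 1) ∧ z = explicitZero N K τ} := by
  have hg : ∀ m, 0 < Nat.gcd m N := fun m => Nat.gcd_pos_of_pos_right m (Nat.pos_of_neZero N)
  ext z
  constructor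
  · intro hz
    obtain ⟨c, rfl⟩ := exists_eq_newtonPoly 1 0 hz.1 hz.2.1
    have hc := (newtonPoly_mem_zeroPolys_iff c).1 hz
    choose τ hτ hcτ using fun k => (natCast_mul_eq_zero_iff _ _).1 (hc k)
    refine ⟨fun k => if h : k - 1 < K then τ ⟨k - 1, h⟩ else 0, fun k hk => ?_, ?_⟩
    · rw [mem_Icc] at hk
      have hlt : k - 1 < K := by omega
      have := hτ ⟨k - 1, hlt⟩
      simp only [Nat.sub_add_cancel hk.1] at this
      simp only [hlt, dite_true]
      omega
    · rw [explicitZero_eq_newtonPoly]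
      congr 1
      ext k
      rw [hcτ k]
      simp
  · rintro ⟨τ, hτ, rfl⟩
    rw [explicitZero_eq_newtonPoly, newtonPoly_mem_zeroPolys_iff]
    intro k
    refine (natCast_mul_eq_zero_iff _ _).2 ⟨_, ?_, rfl⟩
    have := hτ ((k : ℕ) + 1) (by rw [mem_Icc]; have := k.2; omega)
    have := hg (((k : ℕ) + 1).factorial)
    omega

/-! ### Quadratic permutation polynomials -/

theorem eval_quad (f₁ f₂ : ℤ) (x : ZMod N) :
    (quad N f₁ f₂).eval x = (f₁ : ZMod N) * x + (f₂ : ZMod N) * x ^ 2 := by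
  simp [quad]

theorem eval_quad_natCast (f₁ f₂ : ℤ) (i : ℕ) :
    (quad N f₁ f₂).eval (i : ZMod N) = node (f₁ : ZMod N) (f₂ : ZMod N) i := by
  rw [eval_quad, node]
  ring

theorem IsPP.injective_of_dvd {f₁ f₂ : ℤ} (hf : IsPP (quad N f₁ f₂)) {M : ℕ} [NeZero M]
    (hM : M ∣ N) :
    Function.Injective fun x : ZMod M => (f₁ : ZMod M) * x + (f₂ : ZMod M) * x ^ 2 := by
  rw [Finite.injective_iff_surjective]
  intro y
  obtain ⟨y', rfl⟩ := ZMod.castHom_surjective hM y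
  obtain ⟨x', hx'⟩ := hf.2.2 y'
  refine ⟨ZMod.castHom hM (ZMod M) x', ?_⟩
  rw [← hx']
  simp only [eval_quad, map_add, map_mul, map_pow, map_intCast]

/-- Otherwise f takes a value twice modulo p, or modulo 4: at 0 and 2 if 4 ∣ N and f₁ is even; for
odd p with p ∤ f₂, at ±1 or at 0 and -f₁/f₂. -/
theorem IsPP.prime_dvd {f₁ f₂ : ℤ} (hf : IsPP (quad N f₁ f₂))
    (hodd : 2 ∣ N → ¬ 4 ∣ N → Odd f₁) {p : ℕ} (hp : p.Prime) (hpN : p ∣ N) :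
    (p : ℤ) ∣ f₂ ∧ ¬ (p : ℤ) ∣ f₁ := by
  have := Fact.mk hp
  have hinj := hf.injective_of_dvd hpN
  rcases hp.eq_two_or_odd' with rfl | hpo
  · have h1 : Odd f₁ := by
      by_cases h4 : 4 ∣ N
      · by_contra he
        obtain ⟨c, rfl⟩ := Int.not_odd_iff_even.1 he
        refine absurd (hf.injective_of_dvd h4 (a₁ := 0) (a₂ := 2) ?_) (by decide)
        have h4' : (4 : ZMod 4) = 0 := by decide
        push_cast
        linear_combination (-(c : ZMod 4) - (f₂ : ZMod 4)) * h4'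
      · exact hodd hpN h4
    have h2 : Odd (f₁ + f₂) := by
      by_contra he
      rw [Int.not_odd_iff_even, even_iff_two_dvd] at he
      have he' := (ZMod.intCast_zmod_eq_zero_iff_dvd (f₁ + f₂) 2).2 (by exact_mod_cast he)
      refine absurd (hinj (a₁ := 0) (a₂ := 1) ?_) zero_ne_one
      push_cast at he'
      simp [he']
    constructor
    · have := h2.sub_odd h1
      rw [add_sub_cancel_left] at this
      exact_mod_cast even_iff_two_dvd.1 this
    · intro h
      exact Int.not_even_iff_odd.2 h1 (even_iff_two_dvd.2 (by exact_mod_cast h))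
  · rw [← ZMod.intCast_zmod_eq_zero_iff_dvd, ← ZMod.intCast_zmod_eq_zero_iff_dvd]
    have hb : (f₂ : ZMod p) = 0 := by
      by_contra hb
      by_cases ha : (f₁ : ZMod p) = 0
      · have h := hinj (a₁ := 1) (a₂ := -1) (by simp [ha])
        have : Fact (2 < p) := ⟨by
          have := hp.two_le
          rcases hpo with ⟨c, rfl⟩
          omega⟩
        exact ZMod.neg_one_ne_one h.symm
      · have h := hinj (a₁ := 0) (a₂ := -(f₁ : ZMod p) / (f₂ : ZMod p)) (by
          field_simp
          ring)
        rw [eq_comm, div_eq_zero_iff, neg_eq_zero] at h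
        tauto
    refine ⟨hb, fun ha => ?_⟩
    exact zero_ne_one (hinj (a₁ := 0) (a₂ := 1) (by simp [ha, hb]))

theorem IsPP.isUnit_add_mul {f₁ f₂ : ℤ} (hf : IsPP (quad N f₁ f₂))
    (hodd : 2 ∣ N → ¬ 4 ∣ N → Odd f₁) (m : ℕ) :
    IsUnit ((f₁ : ZMod N) + (m : ZMod N) * (f₂ : ZMod N)) := by
  have e : (f₁ : ZMod N) + (m : ZMod N) * (f₂ : ZMod N) = ((f₁ + m * f₂ : ℤ) : ZMod N) := by
    push_cast; rfl
  rw [e, ZMod.coe_int_isUnit_iff_isCoprime, Int.isCoprime_iff_gcd_eq_one, Int.gcd_def,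
    Int.natAbs_natCast]
  refine Nat.Coprime.symm (Nat.coprime_of_dvd fun p hp h1 h2 => ?_)
  obtain ⟨h3, h4⟩ := hf.prime_dvd hodd hp h2
  rw [← Int.natCast_dvd] at h1
  exact h4 ((dvd_add_left (h3.mul_left _)).1 h1)

/-! ### Inverse permutation polynomials -/

/-- The residue 0 is automatic without constant terms, and a left inverse on a finite set is
surjective, hence bijective. -/
theorem isInversePP_iff (hN : 2 ≤ N) {f₁ f₂ : ℤ} (g : (ZMod N)[X]) :
    IsInversePP (quad N f₁ f₂) g ↔ g.coeff 0 = 0 ∧ ∀ i : Fin (N - 1),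
      g.eval (node (f₁ : ZMod N) (f₂ : ZMod N) ((i : ℕ) + 1)) = vecB (ZMod N) (N - 1) i := by
  have : NeZero N := ⟨by omega⟩
  constructor
  · rintro ⟨⟨h0, -⟩, h⟩
    refine ⟨h0, fun i => ?_⟩
    rw [← eval_quad_natCast, h, vecB]
    push_cast
    rfl
  · rintro ⟨h0, h⟩
    have hinv : ∀ x : ZMod N, g.eval ((quad N f₁ f₂).eval x) = x := by
      intro x
      rw [← ZMod.natCast_zmod_val x, eval_quad_natCast]
      have hx := x.val_lt
      rcases Nat.eq_zero_or_pos x.val with hz | hz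
      · rw [hz, node_zero, ← coeff_zero_eq_eval_zero, h0, Nat.cast_zero]
      · have := h ⟨x.val - 1, by omega⟩
        simp only [Nat.sub_add_cancel hz, vecB] at this
        rw [this]
        exact_mod_cast congrArg (Nat.cast (R := ZMod N)) (Nat.sub_add_cancel hz)
    have hbij : Function.Bijective fun x : ZMod N => g.eval x := by
      rw [← Finite.surjective_iff_bijective]
      exact fun x => ⟨_, hinv x⟩
    exact ⟨⟨h0, hbij⟩, hinv⟩

theorem newtonPoly_dite (a b : ZMod N) {K n : ℕ} (hK : K ≤ n) (h : Fin K → ZMod N) :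
    newtonPoly a b (fun k : Fin n => if hk : (k : ℕ) < K then h ⟨k, hk⟩ else 0) =
      newtonPoly a b h := by
  rw [newtonPoly, newtonPoly, Fin.sum_univ_eq_sum_range (fun k : ℕ =>
    C (if hk : k < K then h ⟨k, hk⟩ else 0) * newtonBasis a b (k + 1)) n,
    ← sum_subset (range_mono hK), sum_range]
  · simp
  · intro k _ hk
    rw [dif_neg (by simpa using hk), C_0, zero_mul]

theorem leadMat_matU {R : Type*} [CommRing R] (a b : R) {n K : ℕ} (hK : K ≤ n) :
    leadMat hK (matU a b n) = matU a b K := by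
  ext i j
  simp [leadMat, matU_apply]

theorem leadMat_matD {R : Type*} [CommRing R] {n K : ℕ} (hK : K ≤ n) :
    leadMat hK (matD n : Matrix (Fin n) (Fin n) R) = matD K := by
  ext i j
  simp [leadMat, matD, Matrix.diagonal_apply]

theorem leadVec_vecE {f₁ f₂ : ℤ}
    (hu : ∀ m : ℕ, 1 ≤ m → IsUnit ((f₁ : ZMod N) + (m : ZMod N) * (f₂ : ZMod N)))
    {n K : ℕ} (hK : K ≤ n) :
    leadVec hK (vecE (f₁ : ZMod N) (f₂ : ZMod N) n) =
      Matrix.mulVec (matD K) (particularH N f₁ f₂ K) := by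
  ext k
  simp [leadVec, vecE_eq hu, matD, Matrix.mulVec_diagonal, particularH]

/-- Pad h with zeros to length N-1 and cancel L: the rows beyond K then read 0 = e_k. -/
theorem isInversePP_newtonPoly_iff {f₁ f₂ : ℤ}
    (hu : ∀ m : ℕ, 1 ≤ m → IsUnit ((f₁ : ZMod N) + (m : ZMod N) * (f₂ : ZMod N)))
    (hN : 2 ≤ N) {K : ℕ}
    (hK : K ≤ N - 1) (h : Fin K → ZMod N) :
    IsInversePP (quad N f₁ f₂) (newtonPoly (f₁ : ZMod N) (f₂ : ZMod N) h) ↔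
      Matrix.mulVec (matD K) h = leadVec hK (vecE (f₁ : ZMod N) (f₂ : ZMod N) (N - 1)) ∧
      ∀ k : Fin (N - 1), K ≤ k → vecE (f₁ : ZMod N) (f₂ : ZMod N) (N - 1) k = 0 := by
  rw [isInversePP_iff hN, ← newtonPoly_dite _ _ hK h]
  simp only [coeff_newtonPoly_zero, eval_newtonPoly_node, true_and]
  rw [← funext_iff, ← matL_mulVec_matD_mulVec_particularH hu,
    (Matrix.mulVec_injective_of_isUnit (isUnit_matL _ _ hu (N - 1))).eq_iff, ← vecE_eq hu,
    funext_iff]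
  simp only [matD, Matrix.mulVec_diagonal, funext_iff, leadVec]
  constructor
  · intro H
    refine ⟨fun k => ?_, fun k hk => ?_⟩
    · rw [← H]
      simp
    · rw [← H, dif_neg (by omega), mul_zero]
  · rintro ⟨H1, H2⟩ k
    by_cases hk : (k : ℕ) < K
    · rw [dif_pos hk]
      exact H1 ⟨k, hk⟩
    · rw [dif_neg hk, mul_zero, H2 k (not_lt.1 hk)]

/-! ### Least degree and the set of inverses attaining it -/

theorem factorial_catalan_pow_eq_zero_of_le {f₂ : ℤ} {k l : ℕ} (hkl : k ≤ l)
    (hk : ((((k + 1).factorial : ℤ) * (catalan k : ℤ) * f₂ ^ k : ℤ) : ZMod N) = 0) :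
    ((((l + 1).factorial : ℤ) * (catalan l : ℤ) * f₂ ^ l : ℤ) : ZMod N) = 0 := by
  induction l, hkl using Nat.le_induction with
  | base => exact hk
  | succ l _ ih =>
    have e : ((l + 1 + 1).factorial : ZMod N) * (catalan (l + 1) : ZMod N) =
        ((l + 1).factorial : ZMod N) * (catalan l : ZMod N) * (2 * (2 * (l : ZMod N) + 1)) := by
      exact_mod_cast congrArg (Nat.cast (R := ZMod N)) (factorial_mul_catalan_succ l)
    push_cast at ih ⊢
    rw [e, pow_succ]
    linear_combination (2 * (2 * (l : ZMod N) + 1)) * (f₂ : ZMod N) * ih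

theorem factorial_catalan_pow_pred (hN : 2 ≤ N) (f₂ : ℤ) :
    ((((N - 1 + 1).factorial : ℤ) * (catalan (N - 1) : ℤ) * f₂ ^ (N - 1) : ℤ) : ZMod N) = 0 := by
  have h : ((N.factorial : ℕ) : ZMod N) = 0 :=
    (ZMod.natCast_eq_zero_iff _ _).2 (Nat.dvd_factorial (by omega) le_rfl)
  rw [Nat.sub_add_cancel (by omega : 1 ≤ N)]
  push_cast
  rw [h, zero_mul, zero_mul]

theorem isInversePP_newtonPoly_iff_of_eq_zero {f₁ f₂ : ℤ}
    (hu : ∀ m : ℕ, 1 ≤ m → IsUnit ((f₁ : ZMod N) + (m : ZMod N) * (f₂ : ZMod N)))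
    (hN : 2 ≤ N) {K : ℕ}
    (hK : K ≤ N - 1)
    (h0 : ((((K + 1).factorial : ℤ) * (catalan K : ℤ) * f₂ ^ K : ℤ) : ZMod N) = 0)
    (h : Fin K → ZMod N) :
    IsInversePP (quad N f₁ f₂) (newtonPoly (f₁ : ZMod N) (f₂ : ZMod N) h) ↔
      Matrix.mulVec (matD K) h = leadVec hK (vecE (f₁ : ZMod N) (f₂ : ZMod N) (N - 1)) := by
  rw [isInversePP_newtonPoly_iff hu hN hK, and_iff_left]
  exact fun k hk => (vecE_eq_zero_iff hu _ k).2 (factorial_catalan_pow_eq_zero_of_le hk h0)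

theorem exists_isInversePP_natDegree_le_iff {f₁ f₂ : ℤ}
    (hu : ∀ m : ℕ, 1 ≤ m → IsUnit ((f₁ : ZMod N) + (m : ZMod N) * (f₂ : ZMod N)))
    (hN : 2 ≤ N) {d : ℕ}
    (hd : d ≤ N - 1) :
    (∃ g, IsInversePP (quad N f₁ f₂) g ∧ g.natDegree ≤ d) ↔
      ((((d + 1).factorial : ℤ) * (catalan d : ℤ) * f₂ ^ d : ℤ) : ZMod N) = 0 := by
  constructor
  · rintro ⟨g, hg, hgd⟩
    -- For d = N-1 there is no row left to read off, but N! already vanishes.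
    rcases hd.eq_or_lt with rfl | hlt
    · exact factorial_catalan_pow_pred hN f₂
    · obtain ⟨h, rfl⟩ := exists_eq_newtonPoly (f₁ : ZMod N) (f₂ : ZMod N) hg.1.1 hgd
      exact (vecE_eq_zero_iff hu (N - 1) ⟨d, hlt⟩).1
        (((isInversePP_newtonPoly_iff hu hN hd h).1 hg).2 ⟨d, hlt⟩ le_rfl)
  · intro h0
    exact ⟨newtonPoly _ _ (particularH N f₁ f₂ d),
      (isInversePP_newtonPoly_iff_of_eq_zero hu hN hd h0 _).2 (leadVec_vecE hu hd).symm,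
      natDegree_newtonPoly_le _ _ _⟩

theorem exists_isLeastInverseDegree {f₁ f₂ : ℤ}
    (hu : ∀ m : ℕ, 1 ≤ m → IsUnit ((f₁ : ZMod N) + (m : ZMod N) * (f₂ : ZMod N)))
    (hN : 2 ≤ N) :
    ∃ K, K ≤ N - 1 ∧ IsLeastInverseDegree (quad N f₁ f₂) K ∧
      IsLeast {K : ℕ | 1 ≤ K ∧
        (Nat.factorial (K + 1) : ℤ) * (catalan K : ℤ) * f₂ ^ K ≡ 0 [ZMOD (N : ℤ)]} K := by
  classical
  set A : ℕ → Prop := fun K =>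
    ((((K + 1).factorial : ℤ) * (catalan K : ℤ) * f₂ ^ K : ℤ) : ZMod N) = 0 with hA
  have hmod : ∀ K, (Nat.factorial (K + 1) : ℤ) * (catalan K : ℤ) * f₂ ^ K ≡ 0 [ZMOD (N : ℤ)] ↔
      A K := fun K => by
    rw [← ZMod.intCast_eq_intCast_iff, Int.cast_zero]
  have hex : ∃ K, A K := ⟨_, factorial_catalan_pow_pred hN f₂⟩
  have hle : Nat.find hex ≤ N - 1 := Nat.find_min' hex (factorial_catalan_pow_pred hN f₂)
  -- At K = 0 the expression is 1, so requiring 1 ≤ K does not move the minimum.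
  have hA0 : ¬ A 0 := by
    have : Fact (1 < N) := ⟨hN⟩
    simp [hA]
  have hmin : ∀ g, IsInversePP (quad N f₁ f₂) g → Nat.find hex ≤ g.natDegree := by
    intro g hg
    by_contra! hlt
    exact Nat.find_min hex hlt ((exists_isInversePP_natDegree_le_iff hu hN
      (hlt.le.trans hle)).1 ⟨g, hg, le_rfl⟩)
  refine ⟨Nat.find hex, hle, ⟨?_, ?_⟩, ⟨?_, ?_⟩⟩
  · obtain ⟨g, hg, hgd⟩ :=
      (exists_isInversePP_natDegree_le_iff hu hN hle).2 (Nat.find_spec hex)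
    exact ⟨g, hg, le_antisymm hgd (hmin g hg)⟩
  · rintro d ⟨g, hg, rfl⟩
    exact hmin g hg
  · refine ⟨Nat.one_le_iff_ne_zero.2 fun h => hA0 ?_, (hmod _).2 (Nat.find_spec hex)⟩
    exact h ▸ Nat.find_spec hex
  · rintro K ⟨-, hK⟩
    exact Nat.find_min' hex ((hmod K).1 hK)

theorem IsLeastInverseDegree.mem_inversesOfDegree_iff {f : (ZMod N)[X]} {K : ℕ}
    (hK : IsLeastInverseDegree f K) (g : (ZMod N)[X]) :
    g ∈ inversesOfDegree f K ↔ IsInversePP f g ∧ g.natDegree ≤ K :=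
  and_congr_right fun hg => ⟨le_of_eq, fun h => le_antisymm h (hK.2 ⟨g, hg, rfl⟩)⟩

theorem IsInversePP.add_of_eval_eq_zero {f g z : (ZMod N)[X]} (hg : IsInversePP f g)
    (h0 : z.coeff 0 = 0) (hz : ∀ x, z.eval x = 0) : IsInversePP f (g + z) := by
  refine ⟨⟨by rw [coeff_add, hg.1.1, h0, add_zero], ?_⟩, fun x => ?_⟩
  · simpa [hz] using hg.1.2
  · rw [eval_add, hz, add_zero, hg.2]

/-- Two inverses agree on the image of f, which is everything; minimality of K lets "degree K" be
read as "degree at most K". -/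
theorem inversesOfDegree_eq_add_zeroPolys {f g : (ZMod N)[X]} {K : ℕ}
    (hf : Function.Surjective fun x : ZMod N => f.eval x)
    (hK : IsLeastInverseDegree f K) (hg : g ∈ inversesOfDegree f K) :
    inversesOfDegree f K = {p | ∃ z ∈ zeroPolys N K, p = g + z} := by
  ext p
  rw [hK.mem_inversesOfDegree_iff] at hg ⊢
  constructor
  · rintro ⟨hp, hpd⟩
    refine ⟨p - g, ⟨by rw [coeff_sub, hp.1.1, hg.1.1.1, sub_zero],
      (natDegree_sub_le _ _).trans (max_le hpd hg.2), fun y => ?_⟩, by ring⟩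
    obtain ⟨x, rfl⟩ := hf y
    simp only
    rw [eval_sub, hp.2, hg.1.2, sub_self]
  · rintro ⟨z, ⟨h0, hd, hz⟩, rfl⟩
    exact ⟨hg.1.add_of_eval_eq_zero h0 hz, (natDegree_add_le _ _).trans (max_le hg.2 hd)⟩

end QPP

theorem mainTheorem1 (N : ℕ) (hN : 2 ≤ N) (hN' : N ≤ 2 ^ 50) (f₁ f₂ : ℤ)
    (hf : QPP.IsPP (QPP.quad N f₁ f₂))
    (hodd : 2 ∣ N → ¬ 4 ∣ N → Odd f₁) :
    -- the divisions below are meaningful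
    (∀ m : ℕ, 1 ≤ m → IsUnit ((f₁ : ZMod N) + (m : ZMod N) * (f₂ : ZMod N))) ∧
    IsUnit (QPP.matL (f₁ : ZMod N) (f₂ : ZMod N) (N - 1)) ∧
    -- the least degree of an inverse exists, and is characterized by the congruence
    (∃ K : ℕ, QPP.IsLeastInverseDegree (QPP.quad N f₁ f₂) K) ∧
    (∀ K : ℕ, QPP.IsLeastInverseDegree (QPP.quad N f₁ f₂) K ↔
      IsLeast {K : ℕ | 1 ≤ K ∧
        (Nat.factorial (K + 1) : ℤ) * (catalan K : ℤ) * f₂ ^ K ≡ 0 [ZMOD (N : ℤ)]} K) ∧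
    ∀ K : ℕ, QPP.IsLeastInverseDegree (QPP.quad N f₁ f₂) K →
      -- the number of inverses of least degree
      (QPP.inversesOfDegree (QPP.quad N f₁ f₂) K).ncard =
        ∏ k ∈ Finset.Icc 1 K, Nat.gcd (Nat.factorial k) N ∧
      -- the zero polynomials: their number and form
      (QPP.zeroPolys N K).ncard = ∏ k ∈ Finset.Icc 1 K, Nat.gcd (Nat.factorial k) N ∧
      QPP.zeroPolys N K =
        {z | ∃ τ : ℕ → ℕ,
          (∀ k ∈ Finset.Icc 1 K, τ k ≤ Nat.gcd (Nat.factorial k) N - 1) ∧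
          z = QPP.explicitZero N K τ} ∧
      ∃ hK : K ≤ N - 1,
        -- (1) all inverses of least degree from the linear congruences
        (QPP.inversesOfDegree (QPP.quad N f₁ f₂) K =
          {g | ∃ h v : Fin K → ZMod N,
            Matrix.mulVec (QPP.leadMat hK (QPP.matD (N - 1))) h =
              QPP.leadVec hK (QPP.vecE (f₁ : ZMod N) (f₂ : ZMod N) (N - 1)) ∧
            h = Matrix.mulVec
              (QPP.leadMat hK (QPP.matU (f₁ : ZMod N) (f₂ : ZMod N) (N - 1))) v ∧
            g = QPP.toPoly v}) ∧
        -- (2) all inverses of least degree from one explicit solution and the zero polynomials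
        (∃! v : Fin K → ZMod N,
          QPP.particularH N f₁ f₂ K = Matrix.mulVec
            (QPP.leadMat hK (QPP.matU (f₁ : ZMod N) (f₂ : ZMod N) (N - 1))) v) ∧
        (∀ v : Fin K → ZMod N,
          QPP.particularH N f₁ f₂ K = Matrix.mulVec
            (QPP.leadMat hK (QPP.matU (f₁ : ZMod N) (f₂ : ZMod N) (N - 1))) v →
          QPP.inversesOfDegree (QPP.quad N f₁ f₂) K =
            {g | ∃ z ∈ QPP.zeroPolys N K, g = QPP.toPoly v + z}) := by
  have : NeZero N := ⟨by omega⟩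
  have hu : ∀ m : ℕ, 1 ≤ m → IsUnit ((f₁ : ZMod N) + (m : ZMod N) * (f₂ : ZMod N)) :=
    fun m _ => hf.isUnit_add_mul hodd m
  obtain ⟨K₀, hK₀, hleast, hcong⟩ := QPP.exists_isLeastInverseDegree hu hN
  refine ⟨hu, QPP.isUnit_matL _ _ hu _, ⟨K₀, hleast⟩, fun K => ⟨fun h => ?_, fun h => ?_⟩,
    fun K hKl => ?_⟩
  · rwa [h.unique hleast]
  · rwa [h.unique hcong]
  obtain rfl : K = K₀ := hKl.unique hleast
  have hA := (ZMod.intCast_eq_intCast_iff _ _ N).2 hcong.1.2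
  rw [Int.cast_zero] at hA
  have hinv := QPP.isInversePP_newtonPoly_iff_of_eq_zero hu hN hK₀ hA
  have hpart : ∀ v : Fin K → ZMod N,
      QPP.particularH N f₁ f₂ K =
        Matrix.mulVec (QPP.matU (f₁ : ZMod N) (f₂ : ZMod N) K) v →
      QPP.inversesOfDegree (QPP.quad N f₁ f₂) K =
        {g | ∃ z ∈ QPP.zeroPolys N K, g = QPP.toPoly v + z} := by
    intro v hv
    refine QPP.inversesOfDegree_eq_add_zeroPolys hf.2.2 hKl ?_
    rw [hKl.mem_inversesOfDegree_iff]
    refine ⟨?_, QPP.natDegree_toPoly_le v⟩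
    rw [QPP.toPoly_eq_newtonPoly (f₁ : ZMod N) (f₂ : ZMod N), ← hv, hinv,
      QPP.leadVec_vecE hu hK₀]
  obtain ⟨v₀, hv₀⟩ := QPP.exists_matU_mulVec_eq (f₁ : ZMod N) (f₂ : ZMod N)
    (QPP.particularH N f₁ f₂ K)
  refine ⟨?_, QPP.ncard_zeroPolys K, QPP.zeroPolys_eq_explicitZero K, hK₀, ?_, ?_, ?_⟩
  · rw [hpart v₀ hv₀, ← QPP.ncard_zeroPolys K,
      ← Set.ncard_image_of_injective (QPP.zeroPolys N K)
        (add_right_injective (QPP.toPoly v₀))]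
    congr 1
    ext g
    exact exists_congr fun z => and_congr_right fun _ => eq_comm
  · ext g
    rw [hKl.mem_inversesOfDegree_iff, QPP.leadMat_matU, QPP.leadMat_matD]
    constructor
    · rintro ⟨hg, hgd⟩
      obtain ⟨v, rfl⟩ := QPP.exists_eq_toPoly hg.1.1 hgd
      rw [QPP.toPoly_eq_newtonPoly (f₁ : ZMod N) (f₂ : ZMod N), hinv] at hg
      exact ⟨_, v, hg, rfl, rfl⟩
    · rintro ⟨h, v, hD, rfl, rfl⟩
      refine ⟨?_, QPP.natDegree_toPoly_le v⟩
      rwa [QPP.toPoly_eq_newtonPoly (f₁ : ZMod N) (f₂ : ZMod N), hinv]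
  · rw [QPP.leadMat_matU]
    exact ⟨v₀, hv₀, fun w hw => Matrix.mulVec_injective_of_isUnit (QPP.isUnit_matU _ _ K)
      (hw.symm.trans hv₀)⟩
  · rw [QPP.leadMat_matU]
    exact hpart
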